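/- **Model.** Let $0\le p<1$, $q=1-p$, $d_F=\log(4/q)/\log 2$, and assume $d_F>2$ (that is, $p>0$). Put $\delta=1/(d_F-1)$. In the unit square, the streets of level $l\ge 0$ are the vertical segments $\{b2^{-(l+1)}\}\times[0,1]$ and the horizontal segments $[0,1]\times\{b2^{-(l+1)}\}$, $b=1,3,\dots,2^{l+1}-1$. A random node is on each given street of level $l$ with probability $\frac p2\left(\frac q2\right)^l$, its initial position is uniform on the street and its initial direction is fair. Every node moves along its street at constant speed $v>0$ and is reflected at both ends. The network consists of two nodes $x,y$ on given perpendicular streets $a,b$, with given initial positions and fair initial directions, and of other independent random nodes, whose number is either $n-2$ (exactly $n\ge2$ nodes in all) or Poisson with mean $n$ (the Poisson network of mean size $n$ seen from two of its nodes). A packet starts at $x$ at time $0$; nodes that receive it keep it. At the times $h,2h,3h,\dots$ (with $h>0$) every node that received it earlier transmits it to its nearest neighbours, on both sides, on its street. Along a route, which is a list of streets each crossing the next one, the packet changes street only from one street of the list to the next: when a node with the packet passes the intersection with the next street, the closest node of that street receives it; when a node of the next street passes the intersection, it receives the packet from the closest node of the present street, if that node has it. $T_n(x,y)$ is the time at which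 $y$ receives the packet. On the direct route the list is $a,b$. On the diverted route it is $a,c,d,b$, where $c$ (resp. $d$) is a street perpendicular to $a$ (resp. $b$), of level $H(n)=\max\left(0,\left\lceil\frac{\log(n^{1-\varepsilon/\delta}p/2)}{\log(2/q)}\right\rceil\right)$, closest to the initial position of $x$ (resp. $y$); if $c$ or $d$ carries no node, the direct route is used instead. **Theorem.** In both versions of the network: (i) On the direct route, for all $n\ge 2$, $$\mathbf E[T_n(x,y)]\le hpn+\frac1v .$$ (ii) On the diverted route, for every $\varepsilon>0$, as $n\to\infty$, $$\mathbf E[T_n(x,y)]\le 2hp\,n^{1-\delta+\varepsilon}\left(\frac2p\right)^{\delta}+\frac4q\,h\,n^{\varepsilon/\delta}+\frac3v+O\!\left(n e^{-\frac q2 n^{\varepsilon}}\right),$$ where the constant in $O(\cdot)$ depends only on $p,h,v,\varepsilon$ (not on the streets or initial positions of $x$ and $y$), and the bound holds for all $n\ge2$. -/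

import Mathlib

open MeasureTheory
open scoped ENNReal NNReal

noncomputable section

namespace Hyperfractal

/-! ### Streets -/

/-- A street of the hyperfractal support in the unit square. The street of level `l` and index
`i < 2 ^ l` lies at abscissa (if vertical) or ordinate (if horizontal) `b / 2 ^ (l + 1)` with
`b = 2 i + 1`, so `b` runs through the odd numbers `1, 3, …, 2 ^ (l + 1) - 1`. Every street has
length one and is parametrized by the other coordinate, in `[0, 1]`. -/
structure Street where
  vertical : Bool
  level : ℕ
  index : Fin (2 ^ level)

instance : MeasurableSpace Street := ⊤

/-- The fixed coordinate `b / 2 ^ (l + 1)` of a street. -/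
def Street.coord (s : Street) : ℝ := (2 * (s.index : ℕ) + 1) / 2 ^ (s.level + 1)

/-- Two streets are perpendicular. They then cross, at position `s'.coord` along `s` and at
position `s.coord` along `s'`. -/
def Street.Perp (s s' : Street) : Prop := s.vertical ≠ s'.vertical

/-- `c` is, among all streets of level `H` that are perpendicular to `a`, a closest one to the point
at position `u` of the street `a`. -/
def IsClosestCross (a : Street) (u : ℝ) (H : ℕ) (c : Street) : Prop :=
  c.Perp a ∧ c.level = H ∧
    ∀ s : Street, s.Perp a → s.level = H → |u - c.coord| ≤ |u - s.coord|

/-! ### Parameters -/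

/-- The fractal dimension `d_F = log (4 / q) / log 2`, with `q = 1 - p`. -/
def fractalDim (p : ℝ) : ℝ := Real.log (4 / (1 - p)) / Real.log 2

/-- `δ = 1 / (d_F - 1)`. -/
def delta (p : ℝ) : ℝ := 1 / (fractalDim p - 1)

/-- The level `⌈log (n ^ (1 - ε / δ) p / 2) / log (2 / q)⌉` of the two additional streets of the
diverted route (`0` where this number is negative). -/
def divertLevel (p ε : ℝ) (n : ℕ) : ℕ :=
  ⌈Real.log ((n : ℝ) ^ (1 - ε / delta p) * p / 2) / Real.log (2 / (1 - p))⌉₊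

/-! ### Nodes and their motion -/

/-- A mobile node: its street, its initial position on the street, and its initial direction
(`true`: increasing position). -/
abbrev NodeState : Type := Street × ℝ × Bool

/-- The street on which a node moves. -/
def NodeState.street (s : NodeState) : Street := s.1

/-- The reflection (billiard) map `ℝ → [0, 1]`: the distance to the nearest even integer. It is the
identity on `[0, 1]`, even, and `2`-periodic. -/
def billiard (u : ℝ) : ℝ := |u - 2 * round (u / 2)|

/-- Position at time `t` along its street of a node that moves with constant speed `v` and is
reflected at both ends of the street. -/
def NodeState.pos (v : ℝ) (s : NodeState) (t : ℝ) : ℝ :=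
  billiard (s.2.1 + (if s.2.2 then 1 else -1) * (v * t))

/-! ### Propagation of the packet along a route -/

section Propagation

variable {ι : Type} (h v : ℝ) (σ : ι → NodeState)

/-- At time `t` the nodes `i` and `j` are on the same street, with no node of that street strictly
between them. -/
def Neighbours (i j : ι) (t : ℝ) : Prop :=
  (σ i).street = (σ j).street ∧
    ∀ k, (σ k).street = (σ i).street →
      (σ k).pos v t ∉ Set.uIoo ((σ i).pos v t) ((σ j).pos v t)

/-- At time `t`, no node of the street of `j` is closer than `j` to the point at position `z` of
that street. -/
def IsNearest (j : ι) (z t : ℝ) : Prop :=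
  ∀ k, (σ k).street = (σ j).street → |(σ j).pos v t - z| ≤ |(σ k).pos v t - z|

/-- A street carries at least one node. -/
def Busy (s : Street) : Prop := ∃ i, (σ i).street = s

/-- `HasPacket h v σ r src i t`: at time `t`, node `i` holds the packet emitted at time `0` by the
node `src`, where the packet only travels along the list `r` of streets, changing street only from
one street of the list to the next.

* A node that has the packet keeps it.
* Hop: at each time `k h`, every node that has received the packet before transmits it to its
  nearest neighbours, on both sides, on its street.
* Turn: when a node with the packet passes an intersection with the next street of the route, it
  transmits it to the closest node of that street; and when a node of the next street passes the
  intersection, it receives the packet from the closest node of the present street, if that node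
  has it. -/
inductive HasPacket (r : List Street) (src : ι) : ι → ℝ → Prop
  | source : HasPacket r src src 0
  | carry {i : ι} {s t : ℝ} : HasPacket r src i s → s ≤ t → HasPacket r src i t
  | hop {i j : ι} {s : ℝ} (k : ℕ) : HasPacket r src i s → s < k * h →
      Neighbours v σ i j (k * h) → HasPacket r src j (k * h)
  | turnOut {i j : ι} {t : ℝ} : HasPacket r src i t →
      [(σ i).street, (σ j).street] <:+: r →
      (σ i).pos v t = (σ j).street.coord → IsNearest v σ j (σ i).street.coord t →
      HasPacket r src j t
  | turnIn {i j : ι} {t : ℝ} : HasPacket r src i t →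
      [(σ i).street, (σ j).street] <:+: r →
      (σ j).pos v t = (σ i).street.coord → IsNearest v σ i (σ j).street.coord t →
      HasPacket r src j t

/-- The time (possibly infinite) at which the packet of `src` arrives at `tgt` along the
route `r`. -/
def arrivalTime (r : List Street) (src tgt : ι) : ℝ≥0∞ :=
  ⨅ (t : ℝ) (_ : HasPacket h v σ r src tgt t), ENNReal.ofReal t

end Propagation

/-! ### The random network -/

/-- Law of the street of a node: each street of level `l` has probability `(p / 2) (q / 2) ^ l`. -/
def streetLaw (p : ℝ) : Measure Street :=
  Measure.sum fun s : Street =>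
    ENNReal.ofReal ((p / 2) * ((1 - p) / 2) ^ s.level) • Measure.dirac s

/-- A fair choice between the two directions of motion. -/
def directionLaw : Measure Bool := (PMF.uniformOfFintype Bool).toMeasure

/-- Law of a node: random street, independent uniform position on it, independent fair direction. -/
def nodeLaw (p : ℝ) : Measure NodeState :=
  (streetLaw p).prod ((volume.restrict (Set.Icc (0 : ℝ) 1)).prod directionLaw)

/-- The two usual readings of "a network with `n` nodes" that contains the nodes `x` and `y`:
exactly `n` nodes, or a Poisson process of nodes with mean total mass `n`. -/
inductive Population
  | fixed
  | poisson

/-- Law of the number of nodes other than `x` and `y`. In the Poisson case, the network seen from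
two of its nodes consists of these nodes and an independent copy of the process. -/
def otherCountLaw : Population → ℕ → Measure ℕ
  | .fixed, n => Measure.dirac (n - 2)
  | .poisson, n => ProbabilityTheory.poissonMeasure (n : ℝ≥0)

/-- A sample: the initial directions of `x` and of `y`, the number `m` of other nodes, and a
sequence of nodes of which the first `m` are present in the network. -/
abbrev Sample : Type := Bool × Bool × ℕ × (ℕ → NodeState)

/-- Law of the network: fair directions of `x` and `y`, and i.i.d. other nodes. -/
def networkLaw (p : ℝ) (M : Population) (n : ℕ) : Measure Sample :=
  directionLaw.prod (directionLaw.prod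
    ((otherCountLaw M n).prod (Measure.infinitePi fun _ : ℕ => nodeLaw p)))

/-- The network in which `x` (node `0`) starts at position `x₀` of the street `a`, `y` (node `1`)
starts at position `y₀` of the street `b`, and the other nodes are random. -/
def network (a : Street) (x₀ : ℝ) (b : Street) (y₀ : ℝ) (ω : Sample) :
    Fin (ω.2.2.1 + 2) → NodeState :=
  Matrix.vecCons (a, x₀, ω.1) (Matrix.vecCons (b, y₀, ω.2.1) fun i => ω.2.2.2 i)

/-- Arrival time at `y` of the packet of `x` along the direct route. -/
def directTime (h v : ℝ) (a : Street) (x₀ : ℝ) (b : Street) (y₀ : ℝ) (ω : Sample) : ℝ≥0∞ :=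
  arrivalTime h v (network a x₀ b y₀ ω) [a, b] 0 1

open Classical in
/-- Arrival time at `y` of the packet of `x` along the diverted route through the streets `c`
and `d` if both are busy, and along the direct route otherwise. -/
def divertedTime (h v : ℝ) (a : Street) (x₀ : ℝ) (b : Street) (y₀ : ℝ) (c d : Street)
    (ω : Sample) : ℝ≥0∞ :=
  if Busy (network a x₀ b y₀ ω) c ∧ Busy (network a x₀ b y₀ ω) d then
    arrivalTime h v (network a x₀ b y₀ ω) [a, c, d, b] 0 1
  else directTime h v a x₀ b y₀ ω

/-! ### Expectation -/

/-- Expectation of a nonnegative random time, as an outer integral. It is the usual expectation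
when `T` is measurable, and never smaller than the lower integral. -/
def expect {Ω : Type} [MeasurableSpace Ω] (μ : Measure Ω) (T : Ω → ℝ≥0∞) : ℝ≥0∞ :=
  ⨅ (g : Ω → ℝ≥0∞) (_ : Measurable g) (_ : T ≤ g), ∫⁻ ω, g ω ∂μ

theorem expect_eq_lintegral {Ω : Type} [MeasurableSpace Ω] (μ : Measure Ω) {T : Ω → ℝ≥0∞}
    (hT : Measurable T) : expect μ T = ∫⁻ ω, T ω ∂μ := by
  refine le_antisymm (iInf_le_of_le T (iInf_le_of_le hT (iInf_le_of_le le_rfl le_rfl))) ?_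
  exact le_iInf fun g => le_iInf fun _ => le_iInf fun hg => lintegral_mono hg

/-- The weights of the streets sum to one. -/
theorem isProbabilityMeasure_streetLaw {p : ℝ} (hp0 : 0 < p) (hp1 : p < 1) :
    IsProbabilityMeasure (streetLaw p) := by
  constructor
  let e : Street ≃ Bool × (Σ l : ℕ, Fin (2 ^ l)) :=
    { toFun := fun s => (s.vertical, ⟨s.level, s.index⟩)
      invFun := fun t => ⟨t.1, t.2.1, t.2.2⟩
      left_inv := fun _ => rfl
      right_inv := fun _ => rfl }
  have hq : 0 ≤ (1 - p) / 2 := by linarith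
  rw [streetLaw, Measure.sum_apply _ MeasurableSet.univ]
  simp only [Measure.smul_apply, measure_univ, smul_eq_mul, mul_one]
  rw [← e.symm.tsum_eq]
  refine (ENNReal.tsum_prod (f := fun (_ : Bool) (t : Σ l : ℕ, Fin (2 ^ l)) =>
    ENNReal.ofReal (p / 2 * ((1 - p) / 2) ^ t.1))).trans ?_
  have hσ : ∑' t : (Σ l : ℕ, Fin (2 ^ l)), ENNReal.ofReal (p / 2 * ((1 - p) / 2) ^ t.1)
      = ∑' l : ℕ, (2 : ℝ≥0∞) ^ l * ENNReal.ofReal (p / 2 * ((1 - p) / 2) ^ l) := by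
    refine (ENNReal.tsum_sigma (fun (l : ℕ) (_ : Fin (2 ^ l)) =>
      ENNReal.ofReal (p / 2 * ((1 - p) / 2) ^ l))).trans ?_
    simp
  have key : ∀ l : ℕ, (2 : ℝ≥0∞) ^ l * ENNReal.ofReal (p / 2 * ((1 - p) / 2) ^ l)
      = ENNReal.ofReal (p / 2 * (1 - p) ^ l) := by
    intro l
    rw [show (2 : ℝ≥0∞) = ENNReal.ofReal 2 by simp, ← ENNReal.ofReal_pow (by norm_num),
      ← ENNReal.ofReal_mul (by positivity)]
    congr 1
    rw [div_pow]
    field_simp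
  have hs : HasSum (fun l : ℕ => p / 2 * (1 - p) ^ l) (p / 2 * (1 - (1 - p))⁻¹) :=
    (hasSum_geometric_of_lt_one (by linarith) (by linarith)).mul_left _
  have hv : p / 2 * (1 - (1 - p))⁻¹ = 1 / 2 := by
    rw [sub_sub_cancel]; field_simp
  have hsum : ∑' l : ℕ, ENNReal.ofReal (p / 2 * (1 - p) ^ l) = ENNReal.ofReal (1 / 2) := by
    rw [← ENNReal.ofReal_tsum_of_nonneg _ hs.summable, hs.tsum_eq, hv]
    intro l
    have : 0 ≤ (1 - p) := by linarith
    positivity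
  simp only [hσ, key, hsum, tsum_fintype, Fintype.sum_bool]
  rw [← ENNReal.ofReal_add (by norm_num) (by norm_num)]
  norm_num

/-- The law of a node is a probability measure, so the product law of the network is one as well. -/
theorem isProbabilityMeasure_nodeLaw {p : ℝ} (hp0 : 0 < p) (hp1 : p < 1) :
    IsProbabilityMeasure (nodeLaw p) := by
  have := isProbabilityMeasure_streetLaw hp0 hp1
  have h1 : IsProbabilityMeasure (volume.restrict (Set.Icc (0 : ℝ) 1)) := ⟨by simp⟩
  have h2 : IsProbabilityMeasure directionLaw := by unfold directionLaw; infer_instance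
  unfold nodeLaw
  infer_instance

end Hyperfractal

end

noncomputable section

namespace Hyperfractal

/-! ### Motion -/

/-! The proof separates a pathwise bound from a computation of occupation numbers. Pathwise, the
time splits into waits for a node to pass an intersection, at most `2 / v` each, and the spread of
the packet over a street. At every transmission time at least one more node of a partly informed
street is informed (`HasPacket.fill`), so the spread takes at most `h` times the number of nodes not
yet informed.

On the direct route `x` waits to pass `b`, on average over its direction at most `1 / v`, and then
`b` fills up. On the diverted route there are three waits, and only `c` and `d` have to fill up,
because `y` collects the packet itself when it passes `d`. If `c` or `d` is empty, the direct bound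
applies and costs the number of nodes on `b`, restricted to this rare event.

In expectation a street of level `l` carries at most `n * streetProb p l` other nodes. The nodes of
`b` on the event that `c` is empty contribute at most `e³ n exp (-n * streetProb p c.level)`
(`lintegral_voidCount_le`). The level `H` is chosen so that `n * streetProb p H` lies between `(q /
2) n ^ (ε / δ)` and `n ^ (ε / δ)` once `n ^ (1 - ε / δ) p / 2 ≥ 1`
(`mul_streetProb_divertLevel_mem`). As `δ < 1`, `ε / δ ≥ ε`, whence the error term. The surplus `3 /
v` is absorbed by the term in `n ^ (1 - δ + ε)`, and finitely many `n` by the constant.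

Since `expect` is an outer integral, a measurable majorant suffices and measurability of the arrival
times is not needed. -/

theorem Street.coord_mem_Icc (s : Street) : s.coord ∈ Set.Icc (0 : ℝ) 1 := by
  have h1 : ((s.index : ℕ) : ℝ) + 1 ≤ 2 ^ s.level := by exact_mod_cast s.index.2
  unfold Street.coord
  refine ⟨by positivity, ?_⟩
  rw [div_le_one (by positivity), pow_succ]
  linarith

theorem Street.Perp.ne {s s' : Street} (hs : s.Perp s') : s ≠ s' := by
  rintro rfl
  exact hs rfl

theorem billiard_add_two_mul_int (u : ℝ) (m : ℤ) : billiard (u + 2 * m) = billiard u := by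
  unfold billiard
  rw [show (u + 2 * m) / 2 = u / 2 + m by ring, round_add_intCast]
  push_cast
  congr 1
  ring

theorem billiard_of_mem_Icc {z : ℝ} (hz : z ∈ Set.Icc (0 : ℝ) 1) : billiard z = z := by
  obtain ⟨h0, h1⟩ := hz
  unfold billiard
  -- The endpoint is separate because `round` sends `1 / 2` up to `1`; the value is then `|1 - 2| =
  -- 1`.
  rcases h1.lt_or_eq with h1 | rfl
  · have : round (z / 2) = 0 := by
      rw [round_eq, Int.floor_eq_iff]
      constructor <;> push_cast <;> linarith
    simp [this, abs_of_nonneg h0]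
  · have : round ((1 : ℝ) / 2) = 1 := by
      rw [round_eq, Int.floor_eq_iff]
      constructor <;> push_cast <;> linarith
    rw [this]
    norm_num

theorem billiard_neg_of_mem_Icc {z : ℝ} (hz : z ∈ Set.Icc (0 : ℝ) 1) : billiard (-z) = z := by
  obtain ⟨h0, h1⟩ := hz
  unfold billiard
  have : round (-z / 2) = 0 := by
    rw [round_eq, Int.floor_eq_iff]
    constructor <;> push_cast <;> linarith
  simp [this, abs_of_nonneg h0]

/-- In every time window of length `2 / v`, a node passes every point of its street. -/
theorem NodeState.exists_pos_eq {v : ℝ} (hv : 0 < v) (s : NodeState) {z : ℝ}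
    (hz : z ∈ Set.Icc (0 : ℝ) 1) (t : ℝ) :
    ∃ t', t ≤ t' ∧ t' ≤ t + 2 / v ∧ s.pos v t' = z := by
  obtain ⟨st, u, d⟩ := s
  cases d
  -- In the unfolded line the node is at `u - v t` and moves left; `z + 2 m` is the first copy of
  -- `z` that it meets, less than `2` away. The other direction uses the ceiling.
  · set m : ℤ := ⌊(u - v * t - z) / 2⌋ with hm
    have h1 := Int.floor_le ((u - v * t - z) / 2)
    have h2 := Int.lt_floor_add_one ((u - v * t - z) / 2)
    rw [← hm] at h1 h2
    refine ⟨(u - z - 2 * m) / v, ?_, ?_, ?_⟩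
    · rw [le_div_iff₀ hv]
      linarith
    · rw [div_le_iff₀ hv, add_mul, div_mul_cancel₀ _ hv.ne']
      linarith
    · simp only [NodeState.pos, Bool.false_eq_true, if_false]
      rw [mul_div_cancel₀ _ hv.ne',
        show u + -1 * (u - z - 2 * m) = z + 2 * m by ring, billiard_add_two_mul_int,
        billiard_of_mem_Icc hz]
  · set m : ℤ := ⌈(u + v * t - z) / 2⌉ with hm
    have h1 := Int.le_ceil ((u + v * t - z) / 2)
    have h2 := Int.ceil_lt_add_one ((u + v * t - z) / 2)
    rw [← hm] at h1 h2
    refine ⟨(z + 2 * m - u) / v, ?_, ?_, ?_⟩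
    · rw [le_div_iff₀ hv]
      linarith
    · rw [div_le_iff₀ hv, add_mul, div_mul_cancel₀ _ hv.ne']
      linarith
    · simp only [NodeState.pos, if_true]
      rw [mul_div_cancel₀ _ hv.ne',
        show u + 1 * (z + 2 * m - u) = z + 2 * m by ring, billiard_add_two_mul_int,
        billiard_of_mem_Icc hz]

/-- First passage at `z` of a node that starts at `u` with direction `d`. -/
def passageTime (v u z : ℝ) (d : Bool) : ℝ :=
  (if u ≤ z then (if d then z - u else z + u) else (if d then 2 - z - u else u - z)) / v

/-- In the unfolded line, the four branches hit the copies `-z`, `z`, `z`, `2 - z` of the point `z`.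
-/
theorem pos_passageTime {v : ℝ} (hv : 0 < v) (s : Street) {u z : ℝ}
    (hz : z ∈ Set.Icc (0 : ℝ) 1) (d : Bool) :
    NodeState.pos v (s, u, d) (passageTime v u z d) = z := by
  have h2 : billiard (2 - z) = z := by
    have := billiard_add_two_mul_int (-z) 1
    rw [billiard_neg_of_mem_Icc hz] at this
    rwa [Int.cast_one, mul_one, neg_add_eq_sub] at this
  unfold passageTime NodeState.pos
  rw [mul_div_cancel₀ _ hv.ne']
  cases d <;> by_cases h : u ≤ z <;>
    simp only [h, Bool.false_eq_true, if_false, if_true]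
  · rw [show u + -1 * (z + u) = -z by ring, billiard_neg_of_mem_Icc hz]
  · rw [show u + -1 * (u - z) = z by ring, billiard_of_mem_Icc hz]
  · rw [show u + 1 * (z - u) = z by ring, billiard_of_mem_Icc hz]
  · rw [show u + 1 * (2 - z - u) = 2 - z by ring, h2]

theorem passageTime_nonneg {v : ℝ} (hv : 0 < v) {u z : ℝ} (hu : u ∈ Set.Icc (0 : ℝ) 1)
    (hz : z ∈ Set.Icc (0 : ℝ) 1) (d : Bool) : 0 ≤ passageTime v u z d := by
  obtain ⟨hu0, hu1⟩ := hu
  obtain ⟨hz0, hz1⟩ := hz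
  unfold passageTime
  refine div_nonneg ?_ hv.le
  split_ifs <;> linarith

/-- The initial position cancels: the two distances add up to `2 z` or `2 - 2 z`. Half of this bound
is the mean wait `1 / v` of the direct route. -/
theorem passageTime_add_le {v : ℝ} (hv : 0 < v) {u z : ℝ} (hz : z ∈ Set.Icc (0 : ℝ) 1) :
    passageTime v u z true + passageTime v u z false ≤ 2 / v := by
  obtain ⟨hz0, hz1⟩ := hz
  unfold passageTime
  rw [← add_div]
  gcongr
  split_ifs <;> simp_all <;> linarith

theorem passageTime_le {v : ℝ} (hv : 0 < v) {u z : ℝ} (hu : u ∈ Set.Icc (0 : ℝ) 1)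
    (hz : z ∈ Set.Icc (0 : ℝ) 1) (d : Bool) : passageTime v u z d ≤ 2 / v := by
  have := passageTime_add_le (u := u) hv hz
  have h1 := passageTime_nonneg hv hu hz true
  have h2 := passageTime_nonneg hv hu hz false
  cases d <;> linarith

/-! ### Propagation -/

section Propagation

variable {ι : Type} {h v : ℝ} {σ : ι → NodeState}

theorem exists_isNearest [Finite ι] {s : Street} (hs : Busy σ s) (z t : ℝ) :
    ∃ j, (σ j).street = s ∧ IsNearest v σ j z t := by
  obtain ⟨j, hj, hmin⟩ := Set.exists_min_image {i | (σ i).street = s}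
    (fun i => |(σ i).pos v t - z|) (Set.toFinite _) hs
  exact ⟨j, hj, fun k hk => hmin k (hk.trans hj)⟩

/-- A node that passes the intersection with the next street hands over the packet. -/
theorem HasPacket.exists_turnOut [Finite ι] {r : List Street} {src i : ι} {t : ℝ} {s : Street}
    (hi : HasPacket h v σ r src i t) (hr : [(σ i).street, s] <:+: r) (hs : Busy σ s)
    (hpos : (σ i).pos v t = s.coord) :
    ∃ j, (σ j).street = s ∧ HasPacket h v σ r src j t := by
  obtain ⟨j, rfl, hj⟩ := exists_isNearest (v := v) hs (σ i).street.coord t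
  exact ⟨j, rfl, hi.turnOut hr hpos hj⟩

/-- If some but not all nodes of a street are marked, then some marked node has an unmarked
neighbour. -/
theorem exists_neighbours [Finite ι] {s : Street} {A : Set ι} (t : ℝ) {i j : ι}
    (hi : (σ i).street = s) (hj : (σ j).street = s) (hiA : i ∈ A) (hjA : j ∉ A) :
    ∃ i' j', (σ i').street = s ∧ (σ j').street = s ∧ i' ∈ A ∧ j' ∉ A ∧ Neighbours v σ i' j' t := by
  -- Take a marked and an unmarked node at minimal distance. A node strictly between them, marked or
  -- not, would form a closer such pair with one of the two.
  obtain ⟨⟨i', j'⟩, ⟨hi', hj', hiA', hjA'⟩, hmin⟩ := Set.exists_min_image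
    {x : ι × ι | (σ x.1).street = s ∧ (σ x.2).street = s ∧ x.1 ∈ A ∧ x.2 ∉ A}
    (fun x => |(σ x.1).pos v t - (σ x.2).pos v t|) (Set.toFinite _) ⟨(i, j), hi, hj, hiA, hjA⟩
  refine ⟨i', j', hi', hj', hiA', hjA', hi'.trans hj'.symm, fun k hk hmem => ?_⟩
  rw [hi'] at hk
  simp only at hmin
  by_cases hkA : k ∈ A
  · have := hmin (k, j') ⟨hk, hj', hkA, hjA'⟩
    simp only at this
    rcases le_total ((σ i').pos v t) ((σ j').pos v t) with hle | hle
    · rw [Set.uIoo_of_le hle] at hmem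
      obtain ⟨h1, h2⟩ := hmem
      rw [abs_of_nonpos (by linarith), abs_of_nonpos (by linarith)] at this
      linarith
    · rw [Set.uIoo_of_ge hle] at hmem
      obtain ⟨h1, h2⟩ := hmem
      rw [abs_of_nonneg (by linarith), abs_of_nonneg (by linarith)] at this
      linarith
  · have := hmin (i', k) ⟨hi', hk, hiA', hkA⟩
    simp only at this
    rcases le_total ((σ i').pos v t) ((σ j').pos v t) with hle | hle
    · rw [Set.uIoo_of_le hle] at hmem
      obtain ⟨h1, h2⟩ := hmem
      rw [abs_of_nonpos (by linarith), abs_of_nonpos (by linarith)] at this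
      linarith
    · rw [Set.uIoo_of_ge hle] at hmem
      obtain ⟨h1, h2⟩ := hmem
      rw [abs_of_nonneg (by linarith), abs_of_nonneg (by linarith)] at this
      linarith

/-- The packet spreads over a whole street with `m + 1` nodes within time `m h`. -/
theorem HasPacket.fill [Finite ι] (hh : 0 < h) {r : List Street} {src i : ι} {t : ℝ} {s : Street}
    (ht : 0 ≤ t) (hi : HasPacket h v σ r src i t) (his : (σ i).street = s) {m : ℕ}
    (hm : {j | (σ j).street = s}.ncard ≤ m + 1) {j : ι} (hj : (σ j).street = s) :
    HasPacket h v σ r src j (t + m * h) := by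
  -- `k₀ h` is the first transmission time strictly after `t`, as a hop requires earlier reception;
  -- it is at most `t + h`.
  set k₀ : ℕ := ⌊t / h⌋₊ + 1 with hk₀
  have hlt : t < k₀ * h := by
    rw [← div_lt_iff₀ hh, hk₀]
    push_cast
    exact Nat.lt_floor_add_one _
  have hle : k₀ * h ≤ t + h := by
    have := Nat.floor_le (div_nonneg ht hh.le)
    rw [le_div_iff₀ hh] at this
    rw [hk₀]
    push_cast
    linarith
  -- After `l` transmissions all nodes of the street are informed, or at least `l + 1` are. The
  -- strict bound on `u` makes the next hop legitimate.
  have key : ∀ l : ℕ, ∃ u, u ≤ t + l * h ∧ u < (k₀ + l : ℕ) * h ∧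
      ((∀ j, (σ j).street = s → HasPacket h v σ r src j u) ∨
        l + 1 ≤ {j | (σ j).street = s ∧ HasPacket h v σ r src j u}.ncard) := by
    intro l
    induction l with
    | zero =>
      refine ⟨t, by simp, by simpa using hlt, Or.inr ?_⟩
      rw [zero_add, Nat.one_le_iff_ne_zero, Ne, Set.ncard_eq_zero]
      exact Set.Nonempty.ne_empty ⟨i, his, hi⟩
    | succ l ih =>
      obtain ⟨u, hu1, hu2, hu3⟩ := ih
      refine ⟨(k₀ + l : ℕ) * h, ?_, ?_, ?_⟩
      · push_cast
        linarith
      · push_cast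
        linarith
      by_cases hall : ∀ j, (σ j).street = s → HasPacket h v σ r src j u
      · exact Or.inl fun j hj => (hall j hj).carry hu2.le
      have hcard := hu3.resolve_left hall
      push Not at hall
      obtain ⟨j₀, hj₀, hj₀'⟩ := hall
      obtain ⟨i₀, hi₀, hi₀'⟩ := (Set.ncard_pos (s :=
        {j | (σ j).street = s ∧ HasPacket h v σ r src j u})).1 (by omega)
      obtain ⟨i', j', hi', hj', hiA, hjA, hN⟩ := exists_neighbours (v := v)
        (A := {j | HasPacket h v σ r src j u}) ((k₀ + l : ℕ) * h) hi₀ hj₀ hi₀' hj₀'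
      refine Or.inr (Nat.lt_of_le_of_lt hcard (Set.ncard_lt_ncard ⟨?_, ?_⟩))
      · exact fun x hx => ⟨hx.1, hx.2.carry hu2.le⟩
      · exact fun hsub => hjA (hsub ⟨hj', HasPacket.hop _ hiA hu2 hN⟩).2
  obtain ⟨u, hu1, -, hu3⟩ := key m
  refine HasPacket.carry (s := u) ?_ hu1
  rcases hu3 with hall | hcard
  · exact hall j hj
  · have := Set.eq_of_subset_of_ncard_le
      (s := {j | (σ j).street = s ∧ HasPacket h v σ r src j u}) (t := {j | (σ j).street = s})
      (fun x hx => hx.1) (by omega)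
    exact (this.ge hj).2

/-- Crossing to the next street of the route and spreading over it. -/
theorem HasPacket.cross [Finite ι] (hh : 0 < h) (hv : 0 < v) {r : List Street} {src i : ι} {t : ℝ}
    {s : Street} (ht : 0 ≤ t) (hi : HasPacket h v σ r src i t) (hr : [(σ i).street, s] <:+: r)
    (hs : Busy σ s) {m : ℕ} (hm : {j | (σ j).street = s}.ncard ≤ m + 1) {j : ι}
    (hj : (σ j).street = s) : HasPacket h v σ r src j (t + 2 / v + m * h) := by
  obtain ⟨t', h1, h2, h3⟩ := (σ i).exists_pos_eq hv s.coord_mem_Icc t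
  obtain ⟨j', hj', hp⟩ := (hi.carry h1).exists_turnOut hr hs h3
  exact (hp.fill hh (ht.trans h1) hj' hm hj).carry (by linarith)

theorem arrivalTime_le {r : List Street} {src tgt : ι} {t : ℝ}
    (ht : HasPacket h v σ r src tgt t) : arrivalTime h v σ r src tgt ≤ ENNReal.ofReal t :=
  iInf₂_le t ht

end Propagation

/-! ### Deterministic bounds for the network -/

open Classical in
/-- Number of random nodes, other than `x` and `y`, on the street `s`. -/
def otherCount (s : Street) (ω : ℕ × (ℕ → NodeState)) : ℕ :=
  ((Finset.range ω.1).filter fun i => (ω.2 i).1 = s).card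

section Network

variable {h v : ℝ} {a b : Street} {x₀ y₀ : ℝ} {ω : Sample}

theorem busy_network_of_otherCount_ne_zero {s : Street} (hs : otherCount s ω.2.2 ≠ 0) :
    Busy (network a x₀ b y₀ ω) s := by
  classical
  obtain ⟨i, hi⟩ := Finset.card_ne_zero.1 hs
  rw [Finset.mem_filter, Finset.mem_range] at hi
  exact ⟨(⟨i, hi.1⟩ : Fin ω.2.2.1).succ.succ, hi.2⟩

/-- At most one of `x`, `y` is on a given street, as `a ≠ b`. The resulting `+ 1` matches the node
that already holds the packet in `HasPacket.fill`. -/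
theorem ncard_network_le (hab : a ≠ b) (s : Street) :
    {j | (network a x₀ b y₀ ω j).street = s}.ncard ≤ otherCount s ω.2.2 + 1 := by
  classical
  have h1 : {j | (network a x₀ b y₀ ω j).street = s} ⊆
      {(if s = a then 0 else 1 : Fin (ω.2.2.1 + 2))} ∪
        {j | ∃ i : Fin ω.2.2.1, j = i.succ.succ ∧ (ω.2.2.2 i).1 = s} := by
    intro j hj
    induction j using Fin.cases with
    | zero => left; simp [show s = a from hj.symm]
    | succ j =>
      induction j using Fin.cases with
      | zero =>
        left
        have : s = b := hj.symm
        subst this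
        simp [hab.symm]
      | succ j => exact Or.inr ⟨j, rfl, hj⟩
  refine (Set.ncard_le_ncard h1).trans ((Set.ncard_union_le _ _).trans ?_)
  rw [Set.ncard_singleton, add_comm]
  gcongr
  rw [otherCount, ← Set.ncard_coe_finset]
  refine Set.ncard_le_ncard_of_injOn (fun j => j.val - 2) ?_ ?_ (Finset.finite_toSet _)
  · rintro _ ⟨i, rfl, hi⟩
    simp only [Finset.coe_filter, Finset.mem_range, Set.mem_ofPred_eq, Fin.val_succ]
    exact ⟨i.2, hi⟩
  · rintro _ ⟨i, rfl, hi⟩ _ ⟨i', rfl, hi'⟩ heq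
    simp only [Fin.val_succ] at heq
    have : i = i' := by ext; omega
    rw [this]

theorem directTime_le (hh : 0 < h) (hv : 0 < v) (hab : a ≠ b) (hx : x₀ ∈ Set.Icc (0 : ℝ) 1) :
    directTime h v a x₀ b y₀ ω ≤ ENNReal.ofReal (passageTime v x₀ b.coord ω.1) +
      ENNReal.ofReal h * otherCount b ω.2.2 := by
  have hw := passageTime_nonneg hv hx b.coord_mem_Icc ω.1
  have h0 : HasPacket h v (network a x₀ b y₀ ω) [a, b] 0 0 (passageTime v x₀ b.coord ω.1) :=
    HasPacket.source.carry hw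
  obtain ⟨j, hj, hp⟩ := h0.exists_turnOut (s := b) (List.infix_refl _) ⟨1, rfl⟩
    (pos_passageTime hv a b.coord_mem_Icc ω.1)
  refine (arrivalTime_le (hp.fill (j := 1) hh hw hj (ncard_network_le hab b) rfl)).trans ?_
  rw [ENNReal.ofReal_add hw (by positivity), mul_comm, ENNReal.ofReal_mul hh.le,
    ENNReal.ofReal_natCast]

/-- The three waits are for `x` to pass `c`, for a node of `c` to pass `d`, and for `y` to pass `d`.
By the last one all of `d` is informed, so the node of `d` nearest to the intersection can serve
`y`. -/
theorem arrivalTime_diverted_le (hh : 0 < h) (hv : 0 < v) (hab : a ≠ b) {c d : Street}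
    (hc : Busy (network a x₀ b y₀ ω) c) (hd : Busy (network a x₀ b y₀ ω) d) :
    arrivalTime h v (network a x₀ b y₀ ω) [a, c, d, b] 0 1 ≤
      ENNReal.ofReal (6 / v) +
        ENNReal.ofReal h * (otherCount c ω.2.2 + otherCount d ω.2.2) := by
  have hv2 : 0 ≤ 2 / v := by positivity
  obtain ⟨i, hi⟩ := hc
  have h1 : HasPacket h v (network a x₀ b y₀ ω) [a, c, d, b] 0 i
      (0 + 2 / v + otherCount c ω.2.2 * h) :=
    (HasPacket.source (src := 0)).cross hh hv le_rfl ⟨[], [d, b], rfl⟩ ⟨i, hi⟩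
      (ncard_network_le hab c) hi
  set t₁ := 0 + 2 / v + otherCount c ω.2.2 * h with ht₁
  have ht₁' : 0 ≤ t₁ := by positivity
  have h2 : ∀ j, (network a x₀ b y₀ ω j).street = d →
      HasPacket h v (network a x₀ b y₀ ω) [a, c, d, b] 0 j
        (t₁ + 2 / v + otherCount d ω.2.2 * h) := fun j hj =>
    h1.cross hh hv ht₁' ⟨[a], [b], by simp [hi]⟩ hd (ncard_network_le hab d) hj
  set t₂ := t₁ + 2 / v + otherCount d ω.2.2 * h with ht₂
  obtain ⟨t', hle, hle', hpos⟩ :=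
    (network a x₀ b y₀ ω 1).exists_pos_eq hv d.coord_mem_Icc t₂
  obtain ⟨j, hj, hnear⟩ := exists_isNearest (v := v) hd b.coord t'
  have h3 : HasPacket h v (network a x₀ b y₀ ω) [a, c, d, b] 0 1 t' := by
    refine HasPacket.turnIn (i := j) ((h2 j hj).carry hle) ⟨[a, c], [], ?_⟩ ?_ hnear
    · rw [hj]
      rfl
    · rw [hj]
      exact hpos
  refine (arrivalTime_le (h3.carry hle')).trans ?_
  rw [← Nat.cast_add, ← ENNReal.ofReal_natCast, ← ENNReal.ofReal_mul hh.le,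
    ← ENNReal.ofReal_add (by positivity) (by positivity)]
  refine ENNReal.ofReal_le_ofReal (le_of_eq ?_)
  rw [ht₂, ht₁]
  push_cast
  ring

open Classical in
/-- Number of random nodes on the street `b` if the street `c ≠ b` carries none, and `0`
otherwise. -/
def voidCount (b c : Street) (ω : ℕ × (ℕ → NodeState)) : ℕ :=
  if c ≠ b ∧ otherCount c ω = 0 then otherCount b ω else 0

/-- When the direct route is used, its wait is below `6 / v` and its nodes on `b` are counted by a
void term. The street `c` may coincide with `b`, but then `y` keeps it busy; hence the clause `c ≠
b` in `voidCount`. -/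
theorem divertedTime_le (hh : 0 < h) (hv : 0 < v) (hab : a ≠ b) (hx : x₀ ∈ Set.Icc (0 : ℝ) 1)
    {c d : Street} (hdb : d ≠ b) :
    divertedTime h v a x₀ b y₀ c d ω ≤ ENNReal.ofReal (6 / v) +
      ENNReal.ofReal h * (otherCount c ω.2.2 + otherCount d ω.2.2 +
        voidCount b c ω.2.2 + voidCount b d ω.2.2) := by
  unfold divertedTime
  split_ifs with hbusy
  · refine (arrivalTime_diverted_le hh hv hab hbusy.1 hbusy.2).trans
      (add_le_add le_rfl (mul_le_mul' le_rfl ?_))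
    rw [add_assoc]
    exact le_self_add
  · have hw : passageTime v x₀ b.coord ω.1 ≤ 6 / v :=
      (passageTime_le hv hx b.coord_mem_Icc ω.1).trans (by gcongr; norm_num)
    refine (directTime_le hh hv hab hx).trans ?_
    gcongr
    rcases not_and_or.1 hbusy with hc | hd
    · have hcb : c ≠ b := by
        rintro rfl
        exact hc ⟨1, rfl⟩
      have hc0 : otherCount c ω.2.2 = 0 :=
        not_not.1 fun h => hc (busy_network_of_otherCount_ne_zero h)
      rw [show voidCount b c ω.2.2 = otherCount b ω.2.2 from if_pos ⟨hcb, hc0⟩]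
      exact le_add_right le_add_self
    · have hd0 : otherCount d ω.2.2 = 0 :=
        not_not.1 fun h => hd (busy_network_of_otherCount_ne_zero h)
      rw [show voidCount b d ω.2.2 = otherCount b ω.2.2 from if_pos ⟨hdb, hd0⟩]
      exact le_add_self

end Network

/-! ### Occupation numbers of the streets -/

theorem expect_le {Ω : Type} [MeasurableSpace Ω] (μ : Measure Ω) {T g : Ω → ℝ≥0∞}
    (hg : Measurable g) (h : T ≤ g) : expect μ T ≤ ∫⁻ ω, g ω ∂μ :=
  iInf_le_of_le g (iInf_le_of_le hg (iInf_le_of_le h le_rfl))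

/-- Probability that a node is on a given street of level `l`. -/
def streetProb (p : ℝ) (l : ℕ) : ℝ := p / 2 * ((1 - p) / 2) ^ l

theorem streetProb_nonneg {p : ℝ} (hp0 : 0 ≤ p) (hp1 : p < 1) (l : ℕ) : 0 ≤ streetProb p l := by
  have : 0 ≤ 1 - p := by linarith
  unfold streetProb
  positivity

theorem streetProb_le {p : ℝ} (hp0 : 0 ≤ p) (hp1 : p < 1) (l : ℕ) : streetProb p l ≤ p / 2 := by
  unfold streetProb
  refine mul_le_of_le_one_right (by positivity) (pow_le_one₀ ?_ ?_) <;> linarith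

theorem nodeLaw_street {p : ℝ} (hp0 : 0 < p) (hp1 : p < 1) (S : Set Street) :
    nodeLaw p (Prod.fst ⁻¹' S) = streetLaw p S := by
  have := isProbabilityMeasure_streetLaw hp0 hp1
  have h1 : IsProbabilityMeasure (volume.restrict (Set.Icc (0 : ℝ) 1)) := ⟨by simp⟩
  have h2 : IsProbabilityMeasure directionLaw := by unfold directionLaw; infer_instance
  exact (measurePreserving_fst (μ := streetLaw p)
    (ν := (volume.restrict (Set.Icc (0 : ℝ) 1)).prod directionLaw)).measure_preimage
      MeasurableSpace.measurableSet_top.nullMeasurableSet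

theorem nodeLaw_singleton {p : ℝ} (hp0 : 0 < p) (hp1 : p < 1) (s : Street) :
    nodeLaw p (Prod.fst ⁻¹' {s}) = ENNReal.ofReal (streetProb p s.level) := by
  have : MeasurableSingletonClass Street := ⟨fun _ => MeasurableSpace.measurableSet_top⟩
  rw [nodeLaw_street hp0 hp1, streetLaw, Measure.sum_smul_dirac_singleton, streetProb]

theorem nodeLaw_compl_singleton {p : ℝ} (hp0 : 0 < p) (hp1 : p < 1) (s : Street) :
    nodeLaw p (Prod.fst ⁻¹' {s}ᶜ) = ENNReal.ofReal (1 - streetProb p s.level) := by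
  have := isProbabilityMeasure_nodeLaw hp0 hp1
  rw [Set.preimage_compl, prob_compl_eq_one_sub
    (measurable_fst MeasurableSpace.measurableSet_top), nodeLaw_singleton hp0 hp1,
    ENNReal.ofReal_sub _ (streetProb_nonneg hp0.le hp1 _), ENNReal.ofReal_one]

/-- The event that node `i` is on the street `s` and that all other nodes among the first `m` are on
streets in `S`. -/
def nodeEvent (s : Street) (S : Set Street) (m i : ℕ) : Set (ℕ → NodeState) :=
  Set.pi (Finset.range m) fun j => Prod.fst ⁻¹' (if j = i then {s} else S)

theorem measurableSet_nodeEvent (s : Street) (S : Set Street) (m i : ℕ) :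
    MeasurableSet (nodeEvent s S m i) :=
  MeasurableSet.pi (Finset.countable_toSet _)
    fun _ _ => measurable_fst MeasurableSpace.measurableSet_top

theorem infinitePi_nodeEvent {p : ℝ} (hp0 : 0 < p) (hp1 : p < 1) (s : Street) (S : Set Street)
    {m i : ℕ} (hi : i < m) :
    Measure.infinitePi (fun _ : ℕ => nodeLaw p) (nodeEvent s S m i) =
      nodeLaw p (Prod.fst ⁻¹' {s}) * nodeLaw p (Prod.fst ⁻¹' S) ^ (m - 1) := by
  have := isProbabilityMeasure_nodeLaw hp0 hp1
  rw [nodeEvent, Measure.infinitePi_pi _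
    fun _ _ => measurable_fst MeasurableSpace.measurableSet_top,
    ← Finset.mul_prod_erase _ _ (Finset.mem_range.2 hi), if_pos rfl,
    Finset.prod_congr rfl fun j hj => by rw [if_neg (Finset.ne_of_mem_erase hj)],
    Finset.prod_const, Finset.card_erase_of_mem (Finset.mem_range.2 hi), Finset.card_range]

theorem otherCount_eq_sum (s : Street) (m : ℕ) (ξ : ℕ → NodeState) :
    (otherCount s (m, ξ) : ℝ≥0∞) =
      ∑ i ∈ Finset.range m, (nodeEvent s Set.univ m i).indicator 1 ξ := by
  classical
  rw [otherCount, Finset.card_filter, Nat.cast_sum]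
  refine Finset.sum_congr rfl fun i hi => ?_
  have : ξ ∈ nodeEvent s Set.univ m i ↔ (ξ i).1 = s := by
    refine ⟨fun h => by simpa using h i (by simpa using hi), fun h j _ => ?_⟩
    rcases eq_or_ne j i with rfl | hji
    · simpa using h
    · simp [hji]
  simp only [Set.indicator_apply, this]
  split_ifs <;> simp

/-- Each node on `b` avoids `c` by itself, so emptiness of `c` only constrains the other nodes. The
summands are cylinder events, of probability `P_b (1 - P_c) ^ (m - 1)` by independence. -/
theorem voidCount_eq_sum {b c : Street} (hcb : c ≠ b) (m : ℕ) (ξ : ℕ → NodeState) :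
    (voidCount b c (m, ξ) : ℝ≥0∞) =
      ∑ i ∈ Finset.range m, (nodeEvent b {c}ᶜ m i).indicator 1 ξ := by
  classical
  by_cases h0 : otherCount c (m, ξ) = 0
  · rw [voidCount, if_pos ⟨hcb, h0⟩, otherCount_eq_sum]
    refine Finset.sum_congr rfl fun i hi => ?_
    rw [otherCount, Finset.card_eq_zero, Finset.filter_eq_empty_iff] at h0
    have : ξ ∈ nodeEvent b Set.univ m i ↔ ξ ∈ nodeEvent b {c}ᶜ m i := by
      refine forall₂_congr fun j hj => ?_
      rcases eq_or_ne j i with rfl | hji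
      · simp
      · simpa [hji] using h0 hj
    simp only [Set.indicator_apply, this]
  · rw [voidCount, if_neg fun h => h0 h.2, Nat.cast_zero]
    refine (Finset.sum_eq_zero fun i hi => Set.indicator_of_notMem (fun h => h0 ?_) _).symm
    rw [otherCount, Finset.card_eq_zero, Finset.filter_eq_empty_iff]
    intro j hj
    have := h j hj
    rcases eq_or_ne j i with rfl | hji
    · have hb : (ξ j).1 = b := by simpa using this
      rw [hb]
      exact hcb.symm
    · simpa [hji] using this

theorem measurable_sum_nodeEvent (s : Street) (S : Set Street) (m : ℕ) :
    Measurable fun ξ => ∑ i ∈ Finset.range m,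
      (nodeEvent s S m i).indicator (1 : (ℕ → NodeState) → ℝ≥0∞) ξ :=
  Finset.measurable_sum _ fun i _ =>
    measurable_one.indicator (measurableSet_nodeEvent s S m i)

theorem measurable_otherCount (s : Street) :
    Measurable fun ω : ℕ × (ℕ → NodeState) => (otherCount s ω : ℝ≥0∞) := by
  refine measurable_from_prod_countable_right fun m => ?_
  simp only [otherCount_eq_sum]
  exact measurable_sum_nodeEvent s _ m

theorem measurable_voidCount (b c : Street) :
    Measurable fun ω : ℕ × (ℕ → NodeState) => (voidCount b c ω : ℝ≥0∞) := by
  by_cases hcb : c = b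
  · simp [voidCount, hcb]
  refine measurable_from_prod_countable_right fun m => ?_
  simp only [voidCount_eq_sum hcb]
  exact measurable_sum_nodeEvent b _ m

theorem lintegral_sum_nodeEvent {p : ℝ} (hp0 : 0 < p) (hp1 : p < 1) (s : Street) (S : Set Street)
    (m : ℕ) :
    ∫⁻ ξ, ∑ i ∈ Finset.range m, (nodeEvent s S m i).indicator 1 ξ
        ∂Measure.infinitePi (fun _ : ℕ => nodeLaw p) =
      ENNReal.ofReal (streetProb p s.level) * (m * nodeLaw p (Prod.fst ⁻¹' S) ^ (m - 1)) := by
  rw [lintegral_finsetSum _ fun i _ =>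
    measurable_one.indicator (measurableSet_nodeEvent s S m i)]
  rw [Finset.sum_congr rfl fun i hi => by
    rw [lintegral_indicator_one (measurableSet_nodeEvent s S m i),
      infinitePi_nodeEvent hp0 hp1 s S (Finset.mem_range.1 hi)]]
  rw [Finset.sum_const, Finset.card_range, nsmul_eq_mul, nodeLaw_singleton hp0 hp1]
  ring

/-! ### Number of nodes -/

/-- This is the derivative in `x` of the Poisson generating function `exp (-r (1 - x))`; at `x = 1`
it gives the mean. -/
theorem hasSum_poisson_mul_pow (r x : ℝ) :
    HasSum (fun m : ℕ => Real.exp (-r) * r ^ m / m.factorial * (m * x ^ (m - 1)))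
      (r * Real.exp (-(r * (1 - x)))) := by
  have h1 : HasSum (fun k : ℕ => Real.exp (-r) * r * ((r * x) ^ k / k.factorial))
      (Real.exp (-r) * r * Real.exp (r * x)) := by
    have := NormedSpace.expSeries_div_hasSum_exp (r * x)
    rw [← Real.exp_eq_exp_ℝ] at this
    exact this.mul_left _
  have h2 : Real.exp (-r) * r * Real.exp (r * x) = r * Real.exp (-(r * (1 - x))) := by
    rw [show -(r * (1 - x)) = -r + r * x by ring, Real.exp_add]
    ring
  rw [h2] at h1
  -- The term `m = 0` vanishes, and `m / m! = 1 / (m - 1)!` for the others.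
  refine (hasSum_nat_add_iff' 1).1 ?_
  simp only [Finset.sum_range_one, Nat.cast_zero, zero_mul, mul_zero, sub_zero]
  have h3 : ∀ k : ℕ, Real.exp (-r) * r ^ (k + 1) / (k + 1).factorial *
      ((k + 1 : ℕ) * x ^ (k + 1 - 1)) = Real.exp (-r) * r * ((r * x) ^ k / k.factorial) := ?_
  · simpa only [h3] using h1
  intro k
  rw [Nat.factorial_succ, Nat.add_sub_cancel, mul_pow]
  push_cast
  have : (k.factorial : ℝ) ≠ 0 := by positivity
  field_simp
  ring

theorem lintegral_poisson {n : ℕ} {x : ℝ} (hx0 : 0 ≤ x) :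
    ∫⁻ m, (m * ENNReal.ofReal x ^ (m - 1) : ℝ≥0∞) ∂otherCountLaw .poisson n =
      ENNReal.ofReal (n * Real.exp (-(n * (1 - x)))) := by
  rw [otherCountLaw, ProbabilityTheory.poissonMeasure, lintegral_sum_measure]
  simp only [lintegral_smul_measure, lintegral_dirac, smul_eq_mul, NNReal.coe_natCast]
  have h := hasSum_poisson_mul_pow n x
  rw [← h.tsum_eq, ENNReal.ofReal_tsum_of_nonneg (fun m => by positivity) h.summable]
  refine tsum_congr fun m => ?_
  rw [ENNReal.ofReal_mul (by positivity), ENNReal.ofReal_mul (by positivity),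
    ENNReal.ofReal_pow hx0, ENNReal.ofReal_natCast]

/-- The factor `e³` serves the fixed population: `x ≤ exp (-(1 - x))` is raised to the power `n -
3`, and each of the at most three missing factors costs at most `e`. -/
theorem lintegral_otherCountLaw_le (M : Population) (n : ℕ) {x : ℝ} (hx0 : 0 ≤ x) (hx1 : x ≤ 1) :
    ∫⁻ m, (m * ENNReal.ofReal x ^ (m - 1) : ℝ≥0∞) ∂otherCountLaw M n ≤
      ENNReal.ofReal (Real.exp 3 * (n * Real.exp (-(n * (1 - x))))) := by
  cases M with
  | fixed =>
    rw [otherCountLaw, lintegral_dirac, ← ENNReal.ofReal_natCast, ← ENNReal.ofReal_pow hx0,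
      ← ENNReal.ofReal_mul (by positivity)]
    refine ENNReal.ofReal_le_ofReal ?_
    have h1 : ((n - 2 : ℕ) : ℝ) ≤ n := by exact_mod_cast Nat.sub_le n 2
    have h2 : x ^ (n - 2 - 1) ≤ Real.exp 3 * Real.exp (-(n * (1 - x))) := by
      calc x ^ (n - 2 - 1) ≤ Real.exp (-(1 - x)) ^ (n - 2 - 1) := by
            gcongr
            have := Real.add_one_le_exp (-(1 - x))
            linarith
        _ = Real.exp ((n - 2 - 1 : ℕ) * -(1 - x)) := (Real.exp_nat_mul _ _).symm
        _ ≤ Real.exp (3 + -(n * (1 - x))) := by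
            gcongr
            have h3 : (n : ℝ) ≤ (n - 2 - 1 : ℕ) + 3 := by
              have : n ≤ (n - 2 - 1) + 3 := by omega
              exact_mod_cast this
            nlinarith
        _ = _ := Real.exp_add _ _
    calc _ ≤ (n : ℝ) * (Real.exp 3 * Real.exp (-(n * (1 - x)))) := by gcongr
      _ = _ := by ring
  | poisson =>
    rw [lintegral_poisson hx0]
    refine ENNReal.ofReal_le_ofReal (le_mul_of_one_le_left (by positivity) ?_)
    exact Real.one_le_exp (by norm_num)

theorem lintegral_otherCountLaw_natCast_le (M : Population) (n : ℕ) :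
    ∫⁻ m, (m : ℝ≥0∞) ∂otherCountLaw M n ≤ n := by
  cases M with
  | fixed =>
    rw [otherCountLaw, lintegral_dirac]
    exact_mod_cast Nat.sub_le n 2
  | poisson => simpa using (lintegral_poisson (n := n) zero_le_one).le

instance isProbabilityMeasure_otherCountLaw (M : Population) (n : ℕ) :
    IsProbabilityMeasure (otherCountLaw M n) := by
  cases M <;> unfold otherCountLaw <;> infer_instance

instance isProbabilityMeasure_directionLaw : IsProbabilityMeasure directionLaw := by
  unfold directionLaw
  infer_instance

/-- Law of the number of random nodes and of the sequence of potential nodes. -/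
def othersLaw (p : ℝ) (M : Population) (n : ℕ) : Measure (ℕ × (ℕ → NodeState)) :=
  (otherCountLaw M n).prod (Measure.infinitePi fun _ : ℕ => nodeLaw p)

theorem lintegral_otherCount_le {p : ℝ} (hp0 : 0 < p) (hp1 : p < 1) (M : Population) (n : ℕ)
    (s : Street) : ∫⁻ ω, (otherCount s ω : ℝ≥0∞) ∂othersLaw p M n ≤
      ENNReal.ofReal (streetProb p s.level * n) := by
  have := isProbabilityMeasure_nodeLaw hp0 hp1
  rw [othersLaw, lintegral_prod _ (measurable_otherCount s).aemeasurable]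
  simp only [otherCount_eq_sum, lintegral_sum_nodeEvent hp0 hp1, Set.preimage_univ, measure_univ,
    one_pow, mul_one]
  rw [lintegral_const_mul _ (measurable_of_countable _),
    ENNReal.ofReal_mul (streetProb_nonneg hp0.le hp1 _), ENNReal.ofReal_natCast]
  gcongr
  exact lintegral_otherCountLaw_natCast_le M n

theorem lintegral_voidCount_le {p : ℝ} (hp0 : 0 < p) (hp1 : p < 1) (M : Population) (n : ℕ)
    (b c : Street) : ∫⁻ ω, (voidCount b c ω : ℝ≥0∞) ∂othersLaw p M n ≤
      ENNReal.ofReal (Real.exp 3 * (n * Real.exp (-(n * streetProb p c.level)))) := by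
  have := isProbabilityMeasure_nodeLaw hp0 hp1
  by_cases hcb : c = b
  · simp [voidCount, hcb]
  rw [othersLaw, lintegral_prod _ (measurable_voidCount b c).aemeasurable]
  simp only [voidCount_eq_sum hcb, lintegral_sum_nodeEvent hp0 hp1,
    nodeLaw_compl_singleton hp0 hp1]
  rw [lintegral_const_mul _ (measurable_of_countable _)]
  have h0 := streetProb_nonneg hp0.le hp1 c.level
  have h1 := streetProb_le hp0.le hp1 c.level
  have h2 := streetProb_le hp0.le hp1 b.level
  -- The probability of the street `b` is bounded by `1`, which makes the bound uniform in `b`.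
  refine (mul_le_of_le_one_left (zero_le) (ENNReal.ofReal_le_one.2 (by linarith))).trans ?_
  simpa using lintegral_otherCountLaw_le M n (x := 1 - streetProb p c.level)
    (by linarith) (by linarith)

/-! ### Bounds on the expected arrival times -/

theorem networkLaw_eq (p : ℝ) (M : Population) (n : ℕ) :
    networkLaw p M n = directionLaw.prod (directionLaw.prod (othersLaw p M n)) := rfl

theorem isProbabilityMeasure_othersLaw {p : ℝ} (hp0 : 0 < p) (hp1 : p < 1) (M : Population)
    (n : ℕ) : IsProbabilityMeasure (othersLaw p M n) := by
  have := isProbabilityMeasure_nodeLaw hp0 hp1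
  unfold othersLaw
  infer_instance

theorem lintegral_networkLaw_direction {p : ℝ} (hp0 : 0 < p) (hp1 : p < 1) (M : Population)
    (n : ℕ) (f : Bool → ℝ≥0∞) :
    ∫⁻ ω, f ω.1 ∂networkLaw p M n = (f true + f false) / 2 := by
  have := isProbabilityMeasure_othersLaw hp0 hp1 M n
  rw [networkLaw_eq, (measurePreserving_fst (μ := directionLaw)
    (ν := directionLaw.prod (othersLaw p M n))).lintegral_comp (measurable_of_countable f),
    lintegral_fintype, Fintype.sum_bool]
  simp [directionLaw, div_eq_mul_inv, add_mul]

theorem lintegral_networkLaw_others {p : ℝ} (hp0 : 0 < p) (hp1 : p < 1) (M : Population)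
    (n : ℕ) {f : ℕ × (ℕ → NodeState) → ℝ≥0∞} (hf : Measurable f) :
    ∫⁻ ω, f ω.2.2 ∂networkLaw p M n = ∫⁻ ω, f ω ∂othersLaw p M n := by
  have := isProbabilityMeasure_othersLaw hp0 hp1 M n
  rw [networkLaw_eq, (measurePreserving_snd (μ := directionLaw)
    (ν := directionLaw.prod (othersLaw p M n))).lintegral_comp (f := fun ω => f ω.2)
      (hf.comp measurable_snd),
    (measurePreserving_snd (μ := directionLaw) (ν := othersLaw p M n)).lintegral_comp hf]

theorem expect_directTime_le {p h v : ℝ} (hp0 : 0 < p) (hp1 : p < 1) (hh : 0 < h) (hv : 0 < v)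
    (M : Population) (n : ℕ) {a b : Street} (hab : a ≠ b) {x₀ : ℝ} (hx : x₀ ∈ Set.Icc (0 : ℝ) 1)
    (y₀ : ℝ) :
    expect (networkLaw p M n) (directTime h v a x₀ b y₀) ≤
      ENNReal.ofReal (1 / v + h * (streetProb p b.level * n)) := by
  have hf : Measurable fun ω : Sample => ENNReal.ofReal (passageTime v x₀ b.coord ω.1) :=
    (measurable_of_countable fun d => ENNReal.ofReal (passageTime v x₀ b.coord d)).comp
      measurable_fst
  have hg : Measurable fun ω : Sample => (otherCount b ω.2.2 : ℝ≥0∞) :=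
    (measurable_otherCount b).comp (measurable_snd.comp measurable_snd)
  have hs := streetProb_nonneg hp0.le hp1 b.level
  refine (expect_le _ (hf.add (hg.const_mul _))
    fun ω => directTime_le hh hv hab hx).trans ?_
  simp only [Pi.add_apply]
  rw [lintegral_add_left hf, lintegral_const_mul _ hg,
    lintegral_networkLaw_direction hp0 hp1 M n
      (fun d => ENNReal.ofReal (passageTime v x₀ b.coord d)),
    lintegral_networkLaw_others hp0 hp1 M n (measurable_otherCount b),
    ENNReal.ofReal_add (by positivity) (by positivity), ENNReal.ofReal_mul hh.le]
  gcongr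
  · rw [← ENNReal.ofReal_add (passageTime_nonneg hv hx b.coord_mem_Icc _)
      (passageTime_nonneg hv hx b.coord_mem_Icc _)]
    refine ENNReal.div_le_of_le_mul ?_
    rw [show (2 : ℝ≥0∞) = ENNReal.ofReal 2 by simp, ← ENNReal.ofReal_mul (by positivity)]
    refine ENNReal.ofReal_le_ofReal ((passageTime_add_le hv b.coord_mem_Icc).trans (le_of_eq ?_))
    ring
  · exact lintegral_otherCount_le hp0 hp1 M n b

theorem expect_divertedTime_le {p h v : ℝ} (hp0 : 0 < p) (hp1 : p < 1) (hh : 0 < h) (hv : 0 < v)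
    (M : Population) (n : ℕ) {a b : Street} (hab : a ≠ b) {x₀ : ℝ} (hx : x₀ ∈ Set.Icc (0 : ℝ) 1)
    (y₀ : ℝ) {c d : Street} (hdb : d ≠ b) :
    expect (networkLaw p M n) (divertedTime h v a x₀ b y₀ c d) ≤
      ENNReal.ofReal (6 / v + h * (streetProb p c.level * n + streetProb p d.level * n +
        Real.exp 3 * (n * Real.exp (-(n * streetProb p c.level))) +
        Real.exp 3 * (n * Real.exp (-(n * streetProb p d.level))))) := by
  have hm : Measurable fun ω : Sample => ω.2.2 := measurable_snd.comp measurable_snd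
  have := isProbabilityMeasure_othersLaw hp0 hp1 M n
  have : IsProbabilityMeasure (networkLaw p M n) := by
    rw [networkLaw_eq]
    infer_instance
  have m1 := measurable_otherCount c
  have m2 := measurable_otherCount d
  have m3 := measurable_voidCount b c
  have m4 := measurable_voidCount b d
  have hc := streetProb_nonneg hp0.le hp1 c.level
  have hd := streetProb_nonneg hp0.le hp1 d.level
  have hM : Measurable fun ω : ℕ × (ℕ → NodeState) => (otherCount c ω + otherCount d ω +
      voidCount b c ω + voidCount b d ω : ℝ≥0∞) := ((m1.add m2).add m3).add m4
  refine (expect_le _ (measurable_const.add ((hM.comp hm).const_mul _))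
    fun ω => divertedTime_le hh hv hab hx hdb).trans ?_
  simp only [Pi.add_apply]
  rw [lintegral_add_left measurable_const, lintegral_const, measure_univ, mul_one,
    lintegral_const_mul _ (hM.comp hm)]
  simp only [Function.comp_apply]
  rw [lintegral_networkLaw_others hp0 hp1 M n hM, lintegral_add_right _ m4,
    lintegral_add_right _ m3, lintegral_add_right _ m2,
    ENNReal.ofReal_add (by positivity) (by positivity), ENNReal.ofReal_mul hh.le,
    ENNReal.ofReal_add (by positivity) (by positivity),
    ENNReal.ofReal_add (by positivity) (by positivity),
    ENNReal.ofReal_add (by positivity) (by positivity)]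
  gcongr
  · exact lintegral_otherCount_le hp0 hp1 M n c
  · exact lintegral_otherCount_le hp0 hp1 M n d
  · exact lintegral_voidCount_le hp0 hp1 M n b c
  · exact lintegral_voidCount_le hp0 hp1 M n b d

/-! ### Asymptotics -/

open Filter in
-- The quotient `(U - F) / G` is bounded on the finitely many exceptional indices.
theorem exists_const_of_eventually_le {U F G : ℕ → ℝ} (hG : ∀ n, 2 ≤ n → 0 < G n) {C₀ : ℝ}
    (h : ∀ᶠ n in atTop, U n ≤ F n + C₀ * G n) :
    ∃ C : ℝ, ∀ n, 2 ≤ n → U n ≤ F n + C * G n := by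
  obtain ⟨N, hN⟩ := eventually_atTop.1 h
  obtain ⟨C₁, hC₁⟩ := ((Set.finite_lt_nat N).image fun n => (U n - F n) / G n).bddAbove
  refine ⟨max C₀ C₁, fun n hn => ?_⟩
  have hGn := hG n hn
  rcases le_or_gt N n with hle | hlt
  · refine (hN n hle).trans ?_
    gcongr
    exact le_max_left _ _
  · have h1 := hC₁ (Set.mem_image_of_mem _ hlt)
    rw [div_le_iff₀ hGn] at h1
    have h2 : C₁ * G n ≤ max C₀ C₁ * G n := by
      gcongr
      exact le_max_right _ _
    linarith

/-- At `p = 0` the dimension is `log 4 / log 2`, exactly `2`. -/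
theorem pos_of_two_lt_fractalDim {p : ℝ} (hp0 : 0 ≤ p) (hdF : 2 < fractalDim p) : 0 < p := by
  rcases hp0.lt_or_eq with h | rfl
  · exact h
  · exfalso
    rw [fractalDim, sub_zero, div_one, show (4 : ℝ) = 2 ^ 2 by norm_num, Real.log_pow,
      mul_div_cancel_right₀ _ (Real.log_pos one_lt_two).ne'] at hdF
    norm_num at hdF

theorem delta_pos {p : ℝ} (hdF : 2 < fractalDim p) : 0 < delta p :=
  one_div_pos.2 (by linarith)

theorem delta_lt_one {p : ℝ} (hdF : 2 < fractalDim p) : delta p < 1 := by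
  rw [delta, div_lt_one] <;> linarith

theorem streetProb_divertLevel_of_le {p ε : ℝ} (hp0 : 0 < p) (hp1 : p < 1) {n : ℕ} (hn : 1 ≤ n)
    (hδ : 0 < delta p) (hε : delta p ≤ ε) : streetProb p (divertLevel p ε n) = p / 2 := by
  have hH : divertLevel p ε n = 0 := by
    rw [divertLevel, Nat.ceil_eq_zero]
    have h1 : (n : ℝ) ^ (1 - ε / delta p) ≤ 1 :=
      Real.rpow_le_one_of_one_le_of_nonpos (by exact_mod_cast hn)
        (by rw [sub_nonpos, one_le_div hδ]; exact hε)
    have h0 : 0 ≤ (n : ℝ) ^ (1 - ε / delta p) := by positivity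
    refine div_nonpos_of_nonpos_of_nonneg (Real.log_nonpos (by positivity) (by nlinarith)) ?_
    refine Real.log_nonneg ?_
    rw [le_div_iff₀ (by linarith)]
    linarith
  rw [hH, streetProb, pow_zero, mul_one]

/-- With `x = n ^ (1 - e) p / 2` and `e = ε / δ`, rounding up gives `x ≤ (2 / q) ^ H ≤ x (2 / q)`.
The mean occupation is `(n p / 2) / (2 / q) ^ H`, and `n p / 2 = n ^ e x`. -/
theorem mul_streetProb_divertLevel_mem {p ε : ℝ} (hp0 : 0 < p) (hp1 : p < 1) {n : ℕ} (hn : 1 ≤ n)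
    (hx : 1 ≤ (n : ℝ) ^ (1 - ε / delta p) * p / 2) :
    (1 - p) / 2 * (n : ℝ) ^ (ε / delta p) ≤ n * streetProb p (divertLevel p ε n) ∧
      n * streetProb p (divertLevel p ε n) ≤ (n : ℝ) ^ (ε / delta p) := by
  set e := ε / delta p
  set x := (n : ℝ) ^ (1 - e) * p / 2 with hx_def
  set H := divertLevel p ε n with hH
  have hq : 0 < 1 - p := by linarith
  have hn0 : (0 : ℝ) < n := by exact_mod_cast hn
  have hx0 : 0 < x := by linarith
  have hb : 0 < 2 / (1 - p) := by positivity
  have hL : 0 < Real.log (2 / (1 - p)) := by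
    refine Real.log_pos ?_
    rw [lt_div_iff₀ hq]
    linarith
  have h1 : x ≤ (2 / (1 - p)) ^ H := by
    have := Nat.le_ceil (Real.log x / Real.log (2 / (1 - p)))
    rw [div_le_iff₀ hL] at this
    rwa [← Real.log_le_log_iff hx0 (by positivity), Real.log_pow]
  have h2 : (2 / (1 - p)) ^ H ≤ x * (2 / (1 - p)) := by
    -- Here `1 ≤ x` matters: the natural ceiling is the true one only if `log x` is not too
    -- negative.
    have := Nat.ceil_lt_add_one (div_nonneg (Real.log_nonneg hx) hL.le)
    rw [← sub_lt_iff_lt_add, lt_div_iff₀ hL, sub_mul, one_mul] at this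
    rw [← Real.log_le_log_iff (by positivity) (by positivity), Real.log_pow,
      Real.log_mul hx0.ne' hb.ne']
    change (H : ℝ) * _ - _ < _ at this
    linarith
  have hne : (n : ℝ) ^ e * x = n * (p / 2) := by
    rw [hx_def, mul_div_assoc, ← mul_assoc, ← Real.rpow_add hn0, add_sub_cancel, Real.rpow_one]
  have hsp : n * streetProb p H * (2 / (1 - p)) ^ H = n * (p / 2) := by
    rw [streetProb, mul_assoc, mul_assoc, ← mul_pow, div_mul_div_cancel₀ two_ne_zero,
      div_self hq.ne', one_pow, mul_one]
  have hpos : 0 ≤ n * streetProb p H := mul_nonneg hn0.le (streetProb_nonneg hp0.le hp1 H)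
  constructor
  · have h3 : n * (p / 2) ≤ n * streetProb p H * (x * (2 / (1 - p))) :=
      hsp.ge.trans (mul_le_mul_of_nonneg_left h2 hpos)
    rw [← hne] at h3
    have h4 : (n : ℝ) ^ e ≤ n * streetProb p H * (2 / (1 - p)) := by
      refine le_of_mul_le_mul_right ?_ hx0
      linarith
    rw [← mul_div_assoc, le_div_iff₀ hq] at h4
    linarith
  · have h3 : n * streetProb p H * x ≤ n * (p / 2) :=
      (mul_le_mul_of_nonneg_left h1 hpos).trans hsp.le
    rw [← hne] at h3
    exact le_of_mul_le_mul_right h3 hx0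

open Filter in
-- If `ε ≥ δ`, the level is `0` and the right side contains at least `2 h p n`: half pays for the
-- two streets, half eventually exceeds all constants. If `ε < δ`, the level is large enough for the
-- two-sided estimate, and the void terms give the error term with constant `2 h e³`.
theorem exists_const_divertedTime_bound {p h v ε : ℝ} (hp0 : 0 < p) (hp1 : p < 1)
    (hdF : 2 < fractalDim p) (hh : 0 < h) (hv : 0 < v) (hε : 0 < ε) :
    ∃ C : ℝ, ∀ n : ℕ, 2 ≤ n →
      6 / v + h * (streetProb p (divertLevel p ε n) * n + streetProb p (divertLevel p ε n) * n +
        Real.exp 3 * (n * Real.exp (-(n * streetProb p (divertLevel p ε n)))) +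
        Real.exp 3 * (n * Real.exp (-(n * streetProb p (divertLevel p ε n))))) ≤
      2 * h * p * (n : ℝ) ^ (1 - delta p + ε) * (2 / p) ^ delta p +
        4 / (1 - p) * h * (n : ℝ) ^ (ε / delta p) + 3 / v +
        C * (n * Real.exp (-((1 - p) / 2) * (n : ℝ) ^ ε)) := by
  have hδ := delta_pos hdF
  have hδ1 := delta_lt_one hdF
  have hq : 0 < 1 - p := by linarith
  have hpow : 1 ≤ (2 / p) ^ delta p := by
    refine Real.one_le_rpow ?_ hδ.le
    rw [one_le_div hp0]
    linarith
  refine exists_const_of_eventually_le (C₀ := 2 * h * Real.exp 3)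
    (fun n hn => mul_pos (by positivity) (Real.exp_pos _)) ?_
  have hG : ∀ n : ℕ, 0 ≤ 2 * h * Real.exp 3 * (n * Real.exp (-((1 - p) / 2) * (n : ℝ) ^ ε)) :=
    fun n => by positivity
  rcases le_or_gt (delta p) ε with hle | hlt
  · have hev : ∀ᶠ n : ℕ in atTop, 6 / v + h * (4 * Real.exp 3 / p) ≤ h * p * n :=
      (tendsto_natCast_atTop_atTop.const_mul_atTop (mul_pos hh hp0)).eventually_ge_atTop _
    filter_upwards [hev, eventually_ge_atTop 1] with n h1 hn
    have hn1 : (1 : ℝ) ≤ n := by exact_mod_cast hn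
    rw [streetProb_divertLevel_of_le hp0 hp1 hn hδ hle]
    -- This is `t exp (-t) ≤ 1` at `t = n p / 2`.
    have h2 : n * Real.exp (-(n * (p / 2))) ≤ 2 / p := by
      have := Real.add_one_le_exp (n * (p / 2))
      rw [Real.exp_neg, ← div_eq_mul_inv, div_le_div_iff₀ (Real.exp_pos _) hp0]
      linarith
    have h3 : (n : ℝ) ≤ (n : ℝ) ^ (1 - delta p + ε) :=
      (Real.rpow_one _).symm.le.trans (Real.rpow_le_rpow_of_exponent_le hn1 (by linarith))
    have h4 : 2 * h * p * n * 1 ≤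
        2 * h * p * (n : ℝ) ^ (1 - delta p + ε) * (2 / p) ^ delta p := by gcongr
    have h5 : Real.exp 3 * (n * Real.exp (-(n * (p / 2)))) ≤ Real.exp 3 * (2 / p) := by gcongr
    have h6 : 0 ≤ 4 / (1 - p) * h * (n : ℝ) ^ (ε / delta p) := by positivity
    have h7 : 0 ≤ 3 / v := by positivity
    have h8 : h * (p / 2 * n + p / 2 * n + Real.exp 3 * (n * Real.exp (-(n * (p / 2)))) +
        Real.exp 3 * (n * Real.exp (-(n * (p / 2))))) ≤
        h * (p / 2 * n + p / 2 * n + Real.exp 3 * (2 / p) + Real.exp 3 * (2 / p)) := by gcongr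
    have h9 : h * (p / 2 * n + p / 2 * n + Real.exp 3 * (2 / p) + Real.exp 3 * (2 / p)) =
        h * p * n + h * (4 * Real.exp 3 / p) := by ring
    linarith [hG n]
  · have he : 0 < 1 - ε / delta p := by
      rw [sub_pos, div_lt_one hδ]
      exact hlt
    have hev1 : ∀ᶠ n : ℕ in atTop, 2 / p ≤ (n : ℝ) ^ (1 - ε / delta p) :=
      ((tendsto_rpow_atTop he).comp tendsto_natCast_atTop_atTop).eventually_ge_atTop _
    -- The waits give `6 / v` while the claim allows `3 / v`; the growing first term covers the
    -- difference.
    have hev2 : ∀ᶠ n : ℕ in atTop, 3 / v / (2 * h * p) ≤ (n : ℝ) ^ (1 - delta p + ε) :=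
      ((tendsto_rpow_atTop (by linarith)).comp tendsto_natCast_atTop_atTop).eventually_ge_atTop _
    filter_upwards [hev1, hev2, eventually_ge_atTop 1] with n h1 h2 hn
    have hn1 : (1 : ℝ) ≤ n := by exact_mod_cast hn
    rw [div_le_iff₀ hp0] at h1
    obtain ⟨h3, h4⟩ := mul_streetProb_divertLevel_mem (ε := ε) hp0 hp1 hn (by linarith)
    set lam := n * streetProb p (divertLevel p ε n)
    rw [mul_comm (streetProb p (divertLevel p ε n)) (n : ℝ)]
    rw [div_le_iff₀ (by positivity)] at h2
    have h5 : 2 * h * p * (n : ℝ) ^ (1 - delta p + ε) * 1 ≤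
        2 * h * p * (n : ℝ) ^ (1 - delta p + ε) * (2 / p) ^ delta p := by gcongr
    have h6 : h * (2 * lam) ≤ 4 / (1 - p) * h * (n : ℝ) ^ (ε / delta p) := by
      have : 2 ≤ 4 / (1 - p) := by
        rw [le_div_iff₀ hq]
        linarith
      calc h * (2 * lam) ≤ h * (2 * (n : ℝ) ^ (ε / delta p)) := by gcongr
        _ = 2 * h * (n : ℝ) ^ (ε / delta p) := by ring
        _ ≤ _ := by gcongr
    have h7 : (n : ℝ) ^ ε ≤ (n : ℝ) ^ (ε / delta p) :=
      Real.rpow_le_rpow_of_exponent_le hn1 (by rw [le_div_iff₀ hδ]; nlinarith)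
    have h8 : -lam ≤ -((1 - p) / 2) * (n : ℝ) ^ ε := by
      have : (1 - p) / 2 * (n : ℝ) ^ ε ≤ (1 - p) / 2 * (n : ℝ) ^ (ε / delta p) := by gcongr
      linarith
    have h9 : 2 * h * Real.exp 3 * (n * Real.exp (-lam)) ≤
        2 * h * Real.exp 3 * (n * Real.exp (-((1 - p) / 2) * (n : ℝ) ^ ε)) := by gcongr
    have h10 : 6 / v = 3 / v + 3 / v := by ring
    linarith

end Hyperfractal

end

theorem theorem1 (p h v : ℝ) (hp0 : 0 ≤ p) (hp1 : p < 1) (hdF : 2 < Hyperfractal.fractalDim p)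
    (hh : 0 < h) (hv : 0 < v) (M : Hyperfractal.Population) :
    -- (i) direct route
    (∀ n : ℕ, 2 ≤ n → ∀ a b : Hyperfractal.Street, a.Perp b →
      ∀ x₀ ∈ Set.Icc (0 : ℝ) 1, ∀ y₀ ∈ Set.Icc (0 : ℝ) 1,
      Hyperfractal.expect (Hyperfractal.networkLaw p M n)
          (Hyperfractal.directTime h v a x₀ b y₀)
        ≤ ENNReal.ofReal (h * p * n + 1 / v)) ∧
    -- (ii) diverted route, through the closest streets of the prescribed level
    (∀ ε : ℝ, 0 < ε → ∃ C : ℝ, ∀ n : ℕ, 2 ≤ n → ∀ a b : Hyperfractal.Street, a.Perp b →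
      ∀ x₀ ∈ Set.Icc (0 : ℝ) 1, ∀ y₀ ∈ Set.Icc (0 : ℝ) 1,
      ∀ c d : Hyperfractal.Street,
      Hyperfractal.IsClosestCross a x₀ (Hyperfractal.divertLevel p ε n) c →
      Hyperfractal.IsClosestCross b y₀ (Hyperfractal.divertLevel p ε n) d →
      Hyperfractal.expect (Hyperfractal.networkLaw p M n)
          (Hyperfractal.divertedTime h v a x₀ b y₀ c d)
        ≤ ENNReal.ofReal
            (2 * h * p * (n : ℝ) ^ (1 - Hyperfractal.delta p + ε)
                * (2 / p) ^ Hyperfractal.delta p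
              + 4 / (1 - p) * h * (n : ℝ) ^ (ε / Hyperfractal.delta p)
              + 3 / v
              + C * (n * Real.exp (-((1 - p) / 2) * (n : ℝ) ^ ε)))) := by
  have hp : 0 < p := Hyperfractal.pos_of_two_lt_fractalDim hp0 hdF
  refine ⟨fun n _ a b hab x₀ hx y₀ _ => ?_, fun ε hε => ?_⟩
  · refine (Hyperfractal.expect_directTime_le hp hp1 hh hv M n hab.ne hx y₀).trans
      (ENNReal.ofReal_le_ofReal ?_)
    have h1 : h * (Hyperfractal.streetProb p b.level * n) ≤ h * (p * n) := by
      gcongr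
      exact (Hyperfractal.streetProb_le hp0 hp1 _).trans (by linarith)
    linarith
  · obtain ⟨C, hC⟩ := Hyperfractal.exists_const_divertedTime_bound hp hp1 hdF hh hv hε
    refine ⟨C, fun n hn a b hab x₀ hx y₀ _ c d hc hd => ?_⟩
    have hE := Hyperfractal.expect_divertedTime_le hp hp1 hh hv M n hab.ne hx y₀ (c := c) hd.1.ne
    rw [hc.2.1, hd.2.1] at hE
    exact hE.trans (ENNReal.ofReal_le_ofReal (hC n hn))
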